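/- Write $2^{\aleph_0}$ also for the initial ordinal of this cardinality, and for an ordinal $\alpha$ and $k<\omega$ write $\alpha = k \bmod \omega$ if $\alpha=\omega\cdot\beta+k$ for some ordinal $\beta$. A family $\mathcal A\subseteq\mathcal P(\omega)$ is independent if $\bigcap\mathcal F_0\cap\bigcap\{\omega\setminus A : A\in\mathcal F_1\}$ is infinite for all disjoint finite $\mathcal F_0,\mathcal F_1\subseteq\mathcal A$. Let $\bar A=\langle A_{\alpha,n} : \alpha\le 2^{\aleph_0},\ n<\omega\rangle$ be a good independent sequence, that is, a sequence of subsets of $\omega$ such that - $\{A_{\alpha,n} : \alpha\le 2^{\aleph_0}, n<\omega\}$ is an independent family, and $(\alpha,n)\mapsto A_{\alpha,n}$ is injective; - for all $k,m,n<\omega$ and all $u_\ell\subseteq m$ ($\ell<n$) there are $2^{\aleph_0}$ many ordinals $\alpha\le 2^{\aleph_0}$ with $\alpha = k \bmod\omega$ and $A_{\alpha,\ell}\cap m=u_\ell$ for all $\ell<n$; - for all $i<j<\omega$ there is an $n<\omega$ with $|A_{2^{\aleph_0},n}\cap\{i,j\}|=1$. Let $\tau$ be the vocabulary with unary predicates $P,Q$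 and binary predicates $R_n$ ($n<\omega$). Let $N_2$ be the $\tau$-structure with universe $\{b_i : i<\omega\}\cup\{c_\alpha : \alpha\le 2^{\aleph_0}\}$ (without repetition), $Q^{N_2}=\{b_i : i<\omega\}$, $P^{N_2}=\{c_\alpha : \alpha\le 2^{\aleph_0}\}$, and $R_n^{N_2}\subseteq Q^{N_2}\times P^{N_2}$ given as follows: $(b_i,c_{2^{\aleph_0}})\in R_n^{N_2}$ if and only if $i\in A_{2^{\aleph_0},n}$; and if $\alpha<2^{\aleph_0}$ and $\alpha= m\bmod\omega$, then $(b_i,c_\alpha)\in R_n^{N_2}$ if and only if $n\le m$ and $i\in A_{\alpha,n}$. Let $N_1$ be the restriction of $N_2$ to $\{b_i : i<\omega\}\cup\{c_\alpha : \alpha<2^{\aleph_0}\}$. Let $H((2^{\aleph_0})^+)$ be the set of all sets whose transitive closure has cardinality less than $(2^{\aleph_0})^+$, and let $\mathcal X\prec (H((2^{\aleph_0})^+),\in)$ be a countable elementary submodel with $\bar A\in\mathcal X$. Let $M_1$ be the restriction of $N_2$ to $\{b_i : i<\omega\}\cup\{c_\alpha : \alpha\in 2^{\aleph_0}\cap\mathcal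 X\}$, and let $M_2$ be the restriction of $N_2$ to $\{b_i : i<\omega\}\cup\{c_\alpha : \alpha\in (2^{\aleph_0}+1)\cap\mathcal X\}$. Then 1. $N_1\prec N_2$; 2. $M_1\prec M_2$; 3. $M_1\prec_{\infty,\aleph_0}N_1$, that is, $M_1\subseteq N_1$ and every $\mathcal L_{\infty,\aleph_0}$-formula with finitely many free variables has the same truth value in $M_1$ and in $N_1$ at every tuple of elements of $M_1$. In particular, $M_1$ is extendible: it is countable and $\mathcal L_{\infty,\aleph_0}$-elementarily equivalent to an uncountable structure. -/

import Mathlib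

open Set Cardinal

universe u v w u'

namespace Infinitary

/-- Formulas of the infinitary logic `L_{∞,ℵ₀}` whose free variables are among `x₀, …, x_{n-1}`:
conjunctions over arbitrary index types (in the universe `w`), and quantification over one variable
at a time.  Disjunctions and existential quantifiers are the usual abbreviations. -/
inductive InfFormula (L : FirstOrder.Language.{u, v}) : ℕ → Type (max u v (w + 1))
  | equal {n : ℕ} (s t : L.Term (Fin n)) : InfFormula L n
  | rel {n l : ℕ} (R : L.Relations l)
      (ts : Fin l → L.Term (Fin n)) : InfFormula L n
  | neg {n : ℕ} (φ : InfFormula L n) : InfFormula L n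
  | conj {n : ℕ} {ι : Type w} (φ : ι → InfFormula L n) : InfFormula L n
  | all {n : ℕ} (φ : InfFormula L (n + 1)) : InfFormula L n

/-- Tarskian satisfaction of an `L_{∞,ℵ₀}`-formula. -/
def InfFormula.Realize {L : FirstOrder.Language.{u, v}} {M : Type u'} [L.Structure M] :
    {n : ℕ} → InfFormula.{u, v, w} L n → (Fin n → M) → Prop
  | _, .equal s t, x => s.realize x = t.realize x
  | _, .rel R ts, x => FirstOrder.Language.Structure.RelMap R fun i => (ts i).realize x
  | _, .neg φ, x => ¬ φ.Realize x
  | _, .conj φ, x => ∀ i, (φ i).Realize x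
  | _, .all φ, x => ∀ a : M, φ.Realize (Fin.snoc x a)

/-- `M ≡_{∞,ℵ₀} N`: the two structures satisfy the same `L_{∞,ℵ₀}`-sentences. -/
def InfEquiv (L : FirstOrder.Language.{u, v}) (M N : Type u') [L.Structure M] [L.Structure N] : Prop :=
  ∀ φ : InfFormula.{u, v, w} L 0,
    φ.Realize (Fin.elim0 : Fin 0 → M) ↔ φ.Realize (Fin.elim0 : Fin 0 → N)

/-- A countable structure is extendible if it is `L_{∞,ℵ₀}`-elementarily equivalent to some
uncountable structure. -/
def Extendible (L : FirstOrder.Language.{u, v}) (M : Type u') [L.Structure M] : Prop :=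
  Countable M ∧ ∃ (N : Type u') (_ : L.Structure N), Uncountable N ∧ InfEquiv.{u, v, w} L M N

/-- `S ≺ T` for two substructures of a common structure: `S ⊆ T`, and first-order formulas have the
same truth values in `S` and in `T` at tuples of elements of `S`. -/
def ElemSub {L : FirstOrder.Language.{u, v}} {M : Type u'} [L.Structure M] (S T : L.Substructure M) : Prop :=
  ∃ h : S ≤ T, ∀ (n : ℕ) (φ : L.Formula (Fin n)) (x : Fin n → S),
    φ.Realize (fun i => FirstOrder.Language.Substructure.inclusion h (x i)) ↔ φ.Realize x

/-- `S ≺_{∞,ℵ₀} T` for two substructures of a common structure: `S ⊆ T`, and `L_{∞,ℵ₀}`-formulas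
have the same truth values in `S` and in `T` at (finite) tuples of elements of `S`. -/
def InfElemSub {L : FirstOrder.Language.{u, v}} {M : Type u'} [L.Structure M]
    (S T : L.Substructure M) : Prop :=
  ∃ h : S ≤ T, ∀ (n : ℕ) (φ : InfFormula.{u, v, w} L n) (x : Fin n → S),
    φ.Realize (fun i => FirstOrder.Language.Substructure.inclusion h (x i)) ↔ φ.Realize x

end Infinitary

namespace LarsonShelah

/-! ### Good independent sequences -/

/-- The cardinal `2^ℵ₀` as an (initial) ordinal. -/
noncomputable def cont : Ordinal.{0} := (continuum : Cardinal.{0}).ord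

/-- The index set of the ordinals `α ≤ 2^ℵ₀`. -/
abbrev Idx : Type 1 := Set.Iic cont

/-- The index `2^ℵ₀`. -/
noncomputable def topIdx : Idx := ⟨cont, Set.mem_Iic.2 le_rfl⟩

/-- Families `⟨A_{α,n} : α ≤ 2^ℵ₀, n < ω⟩` of sets of natural numbers. -/
abbrev SetSeq : Type 1 := Idx → ℕ → Set ℕ

/-- Independent families of subsets of `ω`. -/
def IndependentFamily (𝒜 : Set (Set ℕ)) : Prop :=
  ∀ F₀ F₁ : Finset (Set ℕ), (F₀ : Set (Set ℕ)) ⊆ 𝒜 → (F₁ : Set (Set ℕ)) ⊆ 𝒜 → Disjoint F₀ F₁ →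
    ((⋂ B ∈ F₀, B) ∩ ⋂ B ∈ F₁, Bᶜ).Infinite

/-- Good independent sequences.  For an ordinal `α` and `k < ω`, the congruence `α = k mod ω` says
that `α = ω * β + k` for some `β`, that is, `α % ω = k`. -/
structure IsGood (A : SetSeq) : Prop where
  independent : IndependentFamily {B | ∃ α n, B = A α n}
  injective : ∀ α β m n, A α m = A β n → α = β ∧ m = n
  generic : ∀ (k m n : ℕ) (s : Fin n → Set ℕ), (∀ l, s l ⊆ Set.Iio m) →
    #{α : Idx | (α : Ordinal) % Ordinal.omega0 = k ∧
      ∀ l : Fin n, A α l ∩ Set.Iio m = s l} = continuum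
  separating : ∀ i j : ℕ, i < j → ∃ n, (A topIdx n ∩ {i, j}).ncard = 1

/-! ### The vocabulary and the structures -/

/-- The relation symbols: unary `P`, `Q` and binary `R n` for every natural number `n`. -/
inductive TauRel : ℕ → Type
  | P : TauRel 1
  | Q : TauRel 1
  | R (n : ℕ) : TauRel 2

/-- The relational vocabulary `τ = {P, Q, Rₙ : n < ω}`. -/
def tau : FirstOrder.Language.{0, 0} := ⟨fun _ => Empty, TauRel⟩

/-- The underlying set of `N₂`: elements `b i` for `i < ω` and `c α` for `α ≤ 2^ℵ₀`, without
repetition. -/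
inductive N₂ (A : SetSeq) : Type 1
  | b (i : ℕ) : N₂ A
  | c (α : Idx) : N₂ A

/-- `Rₙ(x, y)` in `N₂`. -/
def N₂.relR {A : SetSeq} (n : ℕ) : N₂ A → N₂ A → Prop
  | .b i, .c α =>
      (α = topIdx ∧ i ∈ A α n) ∨
      ((α : Ordinal) < cont ∧ ∃ m : ℕ, (α : Ordinal) % Ordinal.omega0 = m ∧ n ≤ m ∧ i ∈ A α n)
  | _, _ => False

/-- The `τ`-structure on `N₂`. -/
instance N₂.struc (A : SetSeq) : tau.Structure (N₂ A) where
  funMap f := Empty.elim f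
  RelMap r x :=
    match r with
    | TauRel.P => ∃ α, x 0 = N₂.c α
    | TauRel.Q => ∃ i, x 0 = N₂.b i
    | TauRel.R n => N₂.relR n (x 0) (x 1)

/-- The restriction of `N₂` to `{b i : i < ω} ∪ {c α : α ∈ Z}`, for a set `Z` of ordinals. -/
def restr (A : SetSeq) (Z : Set Ordinal.{0}) : tau.Substructure (N₂ A) where
  carrier := {x | (∃ i, x = N₂.b i) ∨ ∃ α : Idx, (α : Ordinal) ∈ Z ∧ x = N₂.c α}
  fun_mem f := Empty.elim f

/-- `N₁`, the restriction of `N₂` to the `b i` and the `c α` with `α < 2^ℵ₀`. -/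
noncomputable def N₁ (A : SetSeq) : tau.Substructure (N₂ A) := restr A (Set.Iio cont)

/-! ### The structure `(H(κ), ∈)` -/

/-- `H(κ)`, the sets whose transitive closure has fewer than `κ` elements; equivalently, those that
are included in a transitive set with fewer than `κ` elements. -/
def H (κ : Cardinal.{0}) : Type 1 :=
  {x : ZFSet.{0} // ∃ t : ZFSet.{0}, t.IsTransitive ∧ x ⊆ t ∧ t.card < κ}

/-- The only symbol of the language of set theory. -/
inductive SetRel : ℕ → Type
  | mem : SetRel 2

/-- The language of set theory. -/
def setLang : FirstOrder.Language.{0, 0} := ⟨fun _ => Empty, SetRel⟩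

/-- `(H(κ), ∈)`. -/
instance H.struc (κ : Cardinal.{0}) : setLang.Structure (H κ) where
  funMap f := Empty.elim f
  RelMap r x :=
    match r with
    | SetRel.mem => (x 0).val ∈ (x 1).val

/-- A set of natural numbers as a set of von Neumann natural numbers. -/
noncomputable def codeSet (B : Set ℕ) : ZFSet.{0} :=
  ZFSet.range fun i : B => ((i : ℕ) : Ordinal.{0}).toZFSet

/-- The sequence `⟨A_{α,n}⟩` as an object of set theory: the function, as a set of ordered pairs,
that sends `(α, n)` to `A_{α,n}`. -/
noncomputable def codeSeq (A : SetSeq) : ZFSet.{0} :=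
  ZFSet.range fun p : Idx × ℕ =>
    ZFSet.pair (ZFSet.pair (p.1 : Ordinal.{0}).toZFSet (p.2 : Ordinal.{0}).toZFSet)
      (codeSet (A p.1 p.2))

/-- The elementary submodels `𝒳 ≺ (H((2^ℵ₀)⁺), ∈)`. -/
abbrev Submodel : Type 1 := setLang.ElementarySubstructure (H (Order.succ continuum))

/-- The set `x` is an element of `𝒳`. -/
def Submodel.Has (X : Submodel) (x : ZFSet.{0}) : Prop := ∃ y ∈ X, y.val = x

/-- The ordinals that are elements of `𝒳`. -/
def Submodel.ordinals (X : Submodel) : Set Ordinal.{0} := {α | X.Has α.toZFSet}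

/-- `M₁`, the restriction of `N₂` to the `b i` and the `c α` with `α ∈ 2^ℵ₀ ∩ 𝒳`. -/
noncomputable def M₁ (A : SetSeq) (X : Submodel) : tau.Substructure (N₂ A) :=
  restr A (Set.Iio cont ∩ Submodel.ordinals X)

/-- `M₂`, the restriction of `N₂` to the `b i` and the `c α` with `α ∈ (2^ℵ₀ + 1) ∩ 𝒳`. -/
noncomputable def M₂ (A : SetSeq) (X : Submodel) : tau.Substructure (N₂ A) :=
  restr A (Set.Iio (cont + 1) ∩ Submodel.ordinals X)

end LarsonShelah

/-! The proof is a back-and-forth argument with finite partial isomorphisms of `N₂`. On `c α` with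
`α < 2^ℵ₀` and `α = k mod ω`, only `R₀, …, R_k` can be nonempty, so the type of `c α` over finitely
many `b i` is a finite pattern, and goodness realizes it by infinitely many `β` with the same
residue (`exists_insert_c`). Conversely, the type of `b i` over finitely many such `c α` involves
only finitely many sets `A α n`, and independence realizes it by infinitely many `b j`
(`exists_insert_b`). A restriction of `N₂` therefore needs only two properties: each of its indices
has a last active relation (`Ranked`), and its indices realize all finite patterns (`Rich`).

Below `2^ℵ₀` every index is ranked with no bound on the level, so the game can be played with all
relations at once and preserves `L_{∞,ℵ₀}` (`realize_infFormula`). The top index has infinitely many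
active relations. A first-order formula, however, mentions only relations up to some level `K`, and
up to that level the top index behaves like an index with residue `K`. The same game, with `K` fixed
throughout, then preserves first-order formulas over any rich set of indices
(`realize_formula_of_agree`).

It remains to see that the indices in `2^ℵ₀ ∩ 𝒳` are rich (`rich_ordinals`). A finite pattern is
definable in `H((2^ℵ₀)⁺)` from the coded sequence, natural numbers and finitely many excluded
elements of `𝒳`. It is realized there by goodness, hence realized in `𝒳` by elementarity. -/

namespace LarsonShelah

variable {A : SetSeq}

/-! ### Back and forth between restrictions of `N₂` -/

/-- The relation `Rₙ` is not trivially empty on `c α`. -/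
def Active (n : ℕ) (α : Idx) : Prop :=
  α = topIdx ∨ ((α : Ordinal) < cont ∧ ∃ m : ℕ, (α : Ordinal) % Ordinal.omega0 = m ∧ n ≤ m)

theorem relR_b_c {n i : ℕ} {α : Idx} :
    N₂.relR n (.b i : N₂ A) (.c α) ↔ Active n α ∧ i ∈ A α n := by
  simp only [N₂.relR, Active]
  grind

@[simp] theorem not_relR_b {n i : ℕ} {x : N₂ A} : ¬ N₂.relR n x (.b i) := by
  cases x <;> simp [N₂.relR]

@[simp] theorem not_relR_c {n : ℕ} {α : Idx} {x : N₂ A} : ¬ N₂.relR n (.c α) x := by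
  simp [N₂.relR]

@[simp] theorem not_relR_self {n : ℕ} {x : N₂ A} : ¬ N₂.relR n x x := by
  cases x <;> simp

theorem active_iff_of_lt {n k : ℕ} {α : Idx} (hα : (α : Ordinal) < cont)
    (hk : (α : Ordinal) % Ordinal.omega0 = k) : Active n α ↔ n ≤ k := by
  have : α ≠ topIdx := by rintro rfl; exact lt_irrefl _ hα
  simp only [Active, this, hα, hk, false_or, true_and, Nat.cast_inj]
  grind

theorem exists_mod_omega0_eq (α : Ordinal.{0}) : ∃ k : ℕ, α % Ordinal.omega0 = k :=
  Ordinal.lt_omega0.1 (Ordinal.mod_lt _ Ordinal.omega0_ne_zero)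

theorem lt_cont_of_ne_topIdx {α : Idx} (h : α ≠ topIdx) : (α : Ordinal) < cont :=
  lt_of_le_of_ne α.2 fun h' => h (Subtype.ext h')

/-- Up to the level `K`, each index in `Z` has a last active relation. -/
def Ranked (K : ℕ∞) (Z : Set Ordinal.{0}) : Prop :=
  ∀ α : Idx, (α : Ordinal) ∈ Z → ∃ k : ℕ, ∀ n : ℕ, (n : ℕ∞) ≤ K → (Active n α ↔ n ≤ k)

theorem ranked_natCast (K : ℕ) (Z : Set Ordinal.{0}) : Ranked K Z := by
  intro α _
  by_cases h : α = topIdx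
  -- All relations are active on the top index, so below level `K` its last one is `K` itself.
  · refine ⟨K, fun n hn => ?_⟩
    simp [Active, h, Nat.cast_le.1 hn]
  · obtain ⟨k, hk⟩ := exists_mod_omega0_eq α
    exact ⟨k, fun n _ => active_iff_of_lt (lt_cont_of_ne_topIdx h) hk⟩

theorem ranked_of_subset_Iio (K : ℕ∞) {Z : Set Ordinal.{0}} (hZ : Z ⊆ Set.Iio cont) :
    Ranked K Z := by
  intro α hα
  obtain ⟨k, hk⟩ := exists_mod_omega0_eq α
  exact ⟨k, fun n _ => active_iff_of_lt (hZ hα) hk⟩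

/-- Every finite pattern is realized in `Z`, outside any given finite set of indices. -/
def Rich (A : SetSeq) (Z : Set Ordinal.{0}) : Prop :=
  ∀ (k n m : ℕ) (s : ℕ → Set ℕ) (F : Set Idx), F.Finite → ∃ α : Idx, (α : Ordinal) ∈ Z ∧
    (α : Ordinal) < cont ∧ α ∉ F ∧ (α : Ordinal) % Ordinal.omega0 = k ∧
    ∀ l < n, ∀ i < m, i ∈ A α l ↔ i ∈ s l

theorem Rich.mono {Z Z' : Set Ordinal.{0}} (h : Rich A Z) (hZ : Z ⊆ Z') : Rich A Z' := by
  intro k n m s F hF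
  obtain ⟨α, hα, h⟩ := h k n m s F hF
  exact ⟨α, hZ hα, h⟩

/-- Of the continuum many indices given by `generic`, only their infinitude matters: one survives
the removal of `F` and of the top index. -/
theorem IsGood.rich (hA : IsGood A) : Rich A (Set.Iio cont) := by
  intro k n m s F hF
  have h := hA.generic k m n (fun l => s l ∩ Set.Iio m) (fun l => Set.inter_subset_right)
  have hinf : {α : Idx | (α : Ordinal) % Ordinal.omega0 = k ∧
      ∀ l : Fin n, A α l ∩ Set.Iio m = s l ∩ Set.Iio m}.Infinite := by
    rw [← Set.infinite_coe_iff, Cardinal.infinite_iff]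
    exact h ▸ aleph0_le_continuum
  obtain ⟨α, hα, hαF⟩ := (hinf.sdiff (hF.insert topIdx)).nonempty
  rw [Set.mem_insert_iff, not_or] at hαF
  refine ⟨α, lt_cont_of_ne_topIdx hαF.1, lt_cont_of_ne_topIdx hαF.1, hαF.2, hα.1, ?_⟩
  intro l hl i hi
  have := congrArg (i ∈ ·) (hα.2 ⟨l, hl⟩)
  simpa [hi] using this

/-- Any prescribed membership pattern on finitely many of the sets `A α n` is realized by infinitely
many natural numbers. -/
theorem IsGood.infinite_pattern (hA : IsGood A) (T : Finset (Idx × ℕ)) (p : Idx × ℕ → Prop) :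
    {i : ℕ | ∀ t ∈ T, i ∈ A t.1 t.2 ↔ p t}.Infinite := by
  classical
  have hinj : ∀ s t : Idx × ℕ, A s.1 s.2 = A t.1 t.2 → s = t := fun s t h =>
    Prod.ext (hA.injective _ _ _ _ h).1 (hA.injective _ _ _ _ h).2
  have h := hA.independent ((T.filter p).image fun t => A t.1 t.2)
    ((T.filter fun t => ¬ p t).image fun t => A t.1 t.2)
    (by simp only [Finset.coe_image]; rintro _ ⟨t, -, rfl⟩; exact ⟨_, _, rfl⟩)
    (by simp only [Finset.coe_image]; rintro _ ⟨t, -, rfl⟩; exact ⟨_, _, rfl⟩)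
    (by
      rw [Finset.disjoint_left]
      intro B hB hB'
      obtain ⟨t, ht, rfl⟩ := Finset.mem_image.1 hB
      obtain ⟨t', ht', h⟩ := Finset.mem_image.1 hB'
      rw [hinj _ _ h] at ht'
      exact (Finset.mem_filter.1 ht').2 (Finset.mem_filter.1 ht).2)
  refine h.mono fun i hi t ht => ?_
  simp only [Finset.mem_image, Set.mem_inter_iff, Set.mem_iInter] at hi
  constructor
  · intro hit
    by_contra hp
    exact hi.2 _ ⟨t, Finset.mem_filter.2 ⟨ht, hp⟩, rfl⟩ hit
  · intro hp
    exact hi.1 _ ⟨t, Finset.mem_filter.2 ⟨ht, hp⟩, rfl⟩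

/-- The two elements of `N₂` are of the same sort and, up to the level `K`, the same relations are
active on them. -/
def SameSort (K : ℕ∞) : N₂ A → N₂ A → Prop
  | .b _, .b _ => True
  | .c α, .c β => ∀ n : ℕ, (n : ℕ∞) ≤ K → (Active n α ↔ Active n β)
  | _, _ => False

theorem SameSort.symm {K : ℕ∞} : ∀ {x y : N₂ A}, SameSort K x y → SameSort K y x
  | .b _, .b _, _ => trivial
  | .c _, .c _, h => fun n hn => (h n hn).symm

theorem SameSort.refl (K : ℕ∞) : ∀ x : N₂ A, SameSort K x x
  | .b _ => trivial
  | .c _ => fun _ _ => Iff.rfl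

/-- The pairs in `T` form a partial isomorphism of `N₂` with respect to the relations up to the
level `K`. -/
structure PartialIso (K : ℕ∞) (T : Set (N₂ A × N₂ A)) : Prop where
  sort : ∀ p ∈ T, SameSort K p.1 p.2
  eq : ∀ p ∈ T, ∀ q ∈ T, (p.1 = q.1 ↔ p.2 = q.2)
  rel : ∀ p ∈ T, ∀ q ∈ T, ∀ n : ℕ, (n : ℕ∞) ≤ K → (N₂.relR n p.1 q.1 ↔ N₂.relR n p.2 q.2)

theorem PartialIso.mono {K : ℕ∞} {S T : Set (N₂ A × N₂ A)} (h : PartialIso K T) (hS : S ⊆ T) :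
    PartialIso K S :=
  ⟨fun p hp => h.sort p (hS hp), fun p hp q hq => h.eq p (hS hp) q (hS hq),
    fun p hp q hq => h.rel p (hS hp) q (hS hq)⟩

theorem PartialIso.swap {K : ℕ∞} {T : Set (N₂ A × N₂ A)} (h : PartialIso K T) :
    PartialIso K (Prod.swap ⁻¹' T) :=
  ⟨fun p hp => (h.sort p.swap hp).symm, fun p hp q hq => (h.eq p.swap hp q.swap hq).symm,
    fun p hp q hq n hn => (h.rel p.swap hp q.swap hq n hn).symm⟩

theorem PartialIso.of_diagonal (K : ℕ∞) {T : Set (N₂ A × N₂ A)} (h : ∀ p ∈ T, p.1 = p.2) :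
    PartialIso K T where
  sort p hp := h p hp ▸ SameSort.refl K _
  eq p hp q hq := by rw [h p hp, h q hq]
  rel p hp q hq n _ := by rw [h p hp, h q hq]

/-- The new pair has to be tested only against the old ones, since no `Rₙ` relates an element to
itself. -/
theorem PartialIso.insert {K : ℕ∞} {T : Set (N₂ A × N₂ A)} (h : PartialIso K T) {x y : N₂ A}
    (hs : SameSort K x y) (hx : ∀ p ∈ T, p.1 ≠ x) (hy : ∀ p ∈ T, p.2 ≠ y)
    (hr : ∀ p ∈ T, ∀ n : ℕ, (n : ℕ∞) ≤ K → (N₂.relR n p.1 x ↔ N₂.relR n p.2 y) ∧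
      (N₂.relR n x p.1 ↔ N₂.relR n y p.2)) :
    PartialIso K (insert (x, y) T) where
  sort := by
    rintro p (rfl | hp)
    exacts [hs, h.sort p hp]
  eq := by
    rintro p (rfl | hp) q (rfl | hq)
    · simp
    · simp [(hx q hq).symm, (hy q hq).symm]
    · simp [hx p hp, hy p hp]
    · exact h.eq p hp q hq
  rel := by
    rintro p (rfl | hp) q (rfl | hq) n hn
    · simp
    · exact (hr q hq n hn).2
    · exact (hr p hp n hn).1
    · exact h.rel p hp q hq n hn

theorem c_mem_restr {Z : Set Ordinal.{0}} {α : Idx} :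
    (.c α : N₂ A) ∈ restr A Z ↔ (α : Ordinal) ∈ Z := by
  change ((∃ i, N₂.c α = N₂.b i) ∨ ∃ β : Idx, (β : Ordinal) ∈ Z ∧ N₂.c α = N₂.c β) ↔ _
  simp

theorem b_mem_restr {Z : Set Ordinal.{0}} {i : ℕ} : (.b i : N₂ A) ∈ restr A Z :=
  Or.inl ⟨i, rfl⟩

/-- Independence controls finitely many sets at a time. `Ranked` bounds the active levels of the
finitely many `c β` in the range of `T`, so only finitely many conditions are imposed on `j`;
infinitely many solutions leave room to avoid the `b j` already used. -/
theorem PartialIso.exists_insert_b (hA : IsGood A) {K : ℕ∞} {Z : Set Ordinal.{0}}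
    (hZ : Ranked K Z) {T : Set (N₂ A × N₂ A)} (hfin : T.Finite) (h : PartialIso K T)
    (hT : ∀ p ∈ T, p.2 ∈ restr A Z) (i : ℕ) (hi : ∀ p ∈ T, p.1 ≠ .b i) :
    ∃ j : ℕ, PartialIso K (Insert.insert (.b i, .b j) T) := by
  have hbound : ∃ N : ℕ, ∀ p ∈ T, ∀ β, p.2 = .c β → ∀ n : ℕ, (n : ℕ∞) ≤ K → Active n β → n ≤ N := by
    have : ∀ p ∈ T, ∃ N : ℕ, ∀ β, p.2 = .c β → ∀ n : ℕ, (n : ℕ∞) ≤ K → Active n β → n ≤ N := by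
      intro p hp
      rcases hq : p.2 with j | β
      · exact ⟨0, by simp⟩
      · obtain ⟨k, hk⟩ := hZ β (c_mem_restr.1 (hq ▸ hT p hp))
        refine ⟨k, ?_⟩
        rintro _ ⟨⟩ n hn hact
        exact (hk n hn).1 hact
    choose! g hg using this
    obtain ⟨N, hN⟩ := (hfin.image g).bddAbove
    exact ⟨N, fun p hp β hβ n hn hact =>
      (hg p hp β hβ n hn hact).trans (hN (Set.mem_image_of_mem g hp))⟩
  obtain ⟨N, hN⟩ := hbound
  have hc : {β : Idx | ∃ p ∈ T, p.2 = .c β}.Finite := by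
    refine (hfin.image Prod.snd).preimage (f := N₂.c) (fun _ _ _ _ h => by simpa using h) |>.subset ?_
    rintro β ⟨p, hp, h⟩
    exact ⟨p, hp, h⟩
  have hb : {j : ℕ | ∃ p ∈ T, p.2 = .b j}.Finite := by
    refine (hfin.image Prod.snd).preimage (f := N₂.b) (fun _ _ _ _ h => by simpa using h) |>.subset ?_
    rintro β ⟨p, hp, h⟩
    exact ⟨p, hp, h⟩
  -- The condition at `(β, n)` is copied from the index paired with `β` in `T`, which is unique
  -- because `T` is injective.
  have hinf := hA.infinite_pattern (hc.toFinset ×ˢ Finset.range (N + 1))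
    (fun t => ∃ α, (.c α, .c t.1) ∈ T ∧ i ∈ A α t.2)
  obtain ⟨j, hj, hjb⟩ := (hinf.sdiff hb).nonempty
  refine ⟨j, h.insert trivial hi (fun p hp hpj => hjb ⟨p, hp, hpj⟩) ?_⟩
  rintro ⟨x, y⟩ hp n hn
  refine ⟨by simp, ?_⟩
  have hs := h.sort _ hp
  rcases x with i' | α <;> rcases y with j' | β
  · simp
  · exact hs.elim
  · exact hs.elim
  simp only [relR_b_c]
  rw [hs n hn]
  refine and_congr_right fun hact => ?_
  rw [hj (β, n) (by
    simp only [Finset.mem_product, Set.Finite.mem_toFinset, Set.mem_ofPred_eq, Finset.mem_range]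
    exact ⟨⟨_, hp, rfl⟩, Nat.lt_succ_of_le (hN _ hp β rfl n hn hact)⟩)]
  constructor
  · exact fun hi => ⟨α, hp, hi⟩
  · rintro ⟨α', hp', hi⟩
    have := (h.eq _ hp' _ hp).2 rfl
    simp only [N₂.c.injEq] at this
    exact this ▸ hi

/-- If `k` is the last active level of `α` up to `K`, an index `β < 2^ℵ₀` with residue `k` has the
same active relations up to `K`. It then suffices that `β` copies `α` at levels up to `k` on the
finitely many `b j` in the range of `T`, which `Rich` provides. The top index is thus also matched
with an index below it. -/
theorem PartialIso.exists_insert_c {K : ℕ∞} {Z Z' : Set Ordinal.{0}} (hZ : Ranked K Z)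
    (hZ' : Rich A Z') {T : Set (N₂ A × N₂ A)} (hfin : T.Finite) (h : PartialIso K T)
    (α : Idx) (hα : (α : Ordinal) ∈ Z) (hαT : ∀ p ∈ T, p.1 ≠ .c α) :
    ∃ β : Idx, (β : Ordinal) ∈ Z' ∧ PartialIso K (Insert.insert (.c α, .c β) T) := by
  obtain ⟨k, hk⟩ := hZ α hα
  have hc : {β : Idx | ∃ p ∈ T, p.2 = .c β}.Finite := by
    refine (hfin.image Prod.snd).preimage (f := N₂.c) (fun _ _ _ _ h => by simpa using h) |>.subset ?_
    rintro β ⟨p, hp, h⟩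
    exact ⟨p, hp, h⟩
  have hb : {j : ℕ | ∃ p ∈ T, p.2 = .b j}.Finite := by
    refine (hfin.image Prod.snd).preimage (f := N₂.b) (fun _ _ _ _ h => by simpa using h) |>.subset ?_
    rintro β ⟨p, hp, h⟩
    exact ⟨p, hp, h⟩
  obtain ⟨m, hm⟩ := hb.bddAbove
  -- The bounds are strict: levels `0, …, k`, and the `b j` with `j ≤ m`.
  obtain ⟨β, hβZ, hβ, hβT, hβk, hβs⟩ := hZ' k (k + 1) (m + 1)
    (fun l => {j | ∃ i, (.b i, .b j) ∈ T ∧ i ∈ A α l}) _ hc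
  have hact : ∀ n : ℕ, (n : ℕ∞) ≤ K → (Active n α ↔ Active n β) := fun n hn => by
    rw [hk n hn, active_iff_of_lt hβ hβk]
  refine ⟨β, hβZ, h.insert hact hαT (fun p hp hpβ => hβT ⟨p, hp, hpβ⟩) ?_⟩
  rintro ⟨x, y⟩ hp n hn
  refine ⟨?_, by simp⟩
  have hs := h.sort _ hp
  rcases x with i | α' <;> rcases y with j | β'
  · simp only [relR_b_c]
    rw [hact n hn]
    refine and_congr_right fun hn' => ?_
    rw [active_iff_of_lt hβ hβk] at hn'
    rw [hβs n (Nat.lt_succ_of_le hn') j (Nat.lt_succ_of_le (hm ⟨_, hp, rfl⟩))]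
    constructor
    · exact fun hi => ⟨i, hp, hi⟩
    · rintro ⟨i', hp', hi⟩
      have := (h.eq _ hp' _ hp).2 rfl
      simp only [N₂.b.injEq] at this
      exact this ▸ hi
  · exact hs.elim
  · exact hs.elim
  · simp

/-- The extension property of finite partial isomorphisms. -/
theorem PartialIso.forth (hA : IsGood A) {K : ℕ∞} {Z Z' : Set Ordinal.{0}} (hZ : Ranked K Z)
    (hZ' : Ranked K Z') (hR : Rich A Z') {T : Set (N₂ A × N₂ A)} (hfin : T.Finite)
    (h : PartialIso K T) (hT : ∀ p ∈ T, p.2 ∈ restr A Z') {x : N₂ A} (hx : x ∈ restr A Z) :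
    ∃ y ∈ restr A Z', PartialIso K (Insert.insert (x, y) T) := by
  by_cases hxT : ∃ p ∈ T, p.1 = x
  · obtain ⟨p, hp, rfl⟩ := hxT
    exact ⟨p.2, hT p hp, by rwa [Set.insert_eq_of_mem hp]⟩
  push Not at hxT
  rcases x with i | α
  · obtain ⟨j, hj⟩ := h.exists_insert_b hA hZ' hfin hT i hxT
    exact ⟨_, b_mem_restr, hj⟩
  · obtain ⟨β, hβ, h⟩ := h.exists_insert_c hZ hR hfin α (c_mem_restr.1 hx) hxT
    exact ⟨_, c_mem_restr.2 hβ, h⟩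

/-! ### Preservation of formulas -/

/-- The graph in `N₂` of the correspondence between two tuples. -/
def tupleGraph {M M' : Type*} [tau.Structure M] [tau.Structure M'] (f : FirstOrder.Language.Embedding tau M (N₂ A))
    (f' : FirstOrder.Language.Embedding tau M' (N₂ A)) {γ : Type*} (x : γ → M) (y : γ → M') : Set (N₂ A × N₂ A) :=
  Set.range fun i => (f (x i), f' (y i))

section

variable {M M' : Type*} [tau.Structure M] [tau.Structure M'] {f : FirstOrder.Language.Embedding tau M (N₂ A)}
  {f' : FirstOrder.Language.Embedding tau M' (N₂ A)} {K : ℕ∞}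

theorem PartialIso.forth_tuple (hA : IsGood A) {Z Z' : Set Ordinal.{0}}
    (hf : Set.range f = restr A Z) (hf' : Set.range f' = restr A Z')
    (hZ : Ranked K Z) (hZ' : Ranked K Z') (hR : Rich A Z') {γ : Type*} [Finite γ]
    {x : γ → M} {y : γ → M'} (h : PartialIso K (tupleGraph f f' x y)) (a : M) :
    ∃ b : M', PartialIso K (Insert.insert (f a, f' b) (tupleGraph f f' x y)) := by
  have ha : f a ∈ restr A Z := by
    rw [← SetLike.mem_coe, ← hf]; exact ⟨a, rfl⟩
  obtain ⟨y', hy', h'⟩ := h.forth hA hZ hZ' hR (Set.finite_range _) (by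
    rintro _ ⟨i, rfl⟩
    rw [← SetLike.mem_coe, ← hf']
    exact ⟨_, rfl⟩) ha
  rw [← SetLike.mem_coe, ← hf'] at hy'
  obtain ⟨b, rfl⟩ := hy'
  exact ⟨b, h'⟩

theorem PartialIso.swap_tuple {γ : Type*} {x : γ → M} {y : γ → M'}
    (h : PartialIso K (tupleGraph f f' x y)) : PartialIso K (tupleGraph f' f y x) :=
  h.swap.mono (by rintro _ ⟨i, rfl⟩; exact ⟨i, rfl⟩)

theorem PartialIso.back_tuple (hA : IsGood A) {Z Z' : Set Ordinal.{0}}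
    (hf : Set.range f = restr A Z) (hf' : Set.range f' = restr A Z')
    (hZ : Ranked K Z) (hZ' : Ranked K Z') (hR : Rich A Z) {γ : Type*} [Finite γ]
    {x : γ → M} {y : γ → M'} (h : PartialIso K (tupleGraph f f' x y)) (b : M') :
    ∃ a : M, PartialIso K (Insert.insert (f a, f' b) (tupleGraph f f' x y)) := by
  obtain ⟨a, ha⟩ := h.swap_tuple.forth_tuple hA hf' hf hZ' hZ hR b
  refine ⟨a, ha.swap.mono ?_⟩
  rintro _ (rfl | ⟨i, rfl⟩)
  exacts [Or.inl rfl, Or.inr ⟨i, rfl⟩]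

theorem exists_eq_var {γ : Type*} (t : tau.Term γ) : ∃ i, t = .var i := by
  cases t with
  | var i => exact ⟨i, rfl⟩
  | func F => exact Empty.elim F

theorem PartialIso.realize_equal {γ : Type*} {x : γ → M} {y : γ → M'}
    (h : PartialIso K (tupleGraph f f' x y)) (s t : tau.Term γ) :
    s.realize x = t.realize x ↔ s.realize y = t.realize y := by
  obtain ⟨i, rfl⟩ := exists_eq_var s
  obtain ⟨j, rfl⟩ := exists_eq_var t
  simpa using h.eq _ ⟨i, rfl⟩ _ ⟨j, rfl⟩

/-- The index of a relation symbol. -/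
def TauRel.level : {l : ℕ} → TauRel l → ℕ
  | _, .P => 0
  | _, .Q => 0
  | _, .R n => n

theorem PartialIso.realize_rel {γ : Type*} {x : γ → M} {y : γ → M'}
    (h : PartialIso K (tupleGraph f f' x y)) {l : ℕ} (R : tau.Relations l)
    (hR : (TauRel.level R : ℕ∞) ≤ K) (ts : Fin l → tau.Term γ) :
    FirstOrder.Language.Structure.RelMap R (fun i => (ts i).realize x) ↔
      FirstOrder.Language.Structure.RelMap R (fun i => (ts i).realize y) := by
  choose g hg using fun i => exists_eq_var (ts i)
  simp only [hg, FirstOrder.Language.Term.realize_var]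
  rw [← f.map_rel, ← f'.map_rel]
  cases R with
  | P =>
    change (∃ α, f (x (g 0)) = .c α) ↔ ∃ α, f' (y (g 0)) = .c α
    have := h.sort _ ⟨g 0, rfl⟩
    revert this
    dsimp only
    rcases f (x (g 0)) with _ | _ <;> rcases f' (y (g 0)) with _ | _ <;> simp [SameSort]
  | Q =>
    change (∃ i, f (x (g 0)) = .b i) ↔ ∃ i, f' (y (g 0)) = .b i
    have := h.sort _ ⟨g 0, rfl⟩
    revert this
    dsimp only
    rcases f (x (g 0)) with _ | _ <;> rcases f' (y (g 0)) with _ | _ <;> simp [SameSort]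
  | R n => exact h.rel _ ⟨g 0, rfl⟩ _ ⟨g 1, rfl⟩ n hR

theorem tupleGraph_snoc_subset {n : ℕ} (x : Fin n → M) (y : Fin n → M') (a : M) (b : M') :
    tupleGraph f f' (Fin.snoc x a : Fin (n + 1) → M) (Fin.snoc y b : Fin (n + 1) → M') ⊆
      Insert.insert (f a, f' b) (tupleGraph f f' x y) := by
  rintro _ ⟨i, rfl⟩
  refine Fin.lastCases ?_ (fun i => ?_) i
  · simp
  · simpa using Or.inr ⟨i, rfl⟩

theorem tupleGraph_elim_snoc_subset {γ : Type*} {n : ℕ} (v : γ → M) (v' : γ → M')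
    (x : Fin n → M) (y : Fin n → M') (a : M) (b : M') :
    tupleGraph f f' (Sum.elim v (Fin.snoc x a : Fin (n + 1) → M))
        (Sum.elim v' (Fin.snoc y b : Fin (n + 1) → M')) ⊆
      Insert.insert (f a, f' b) (tupleGraph f f' (Sum.elim v x) (Sum.elim v' y)) := by
  rintro _ ⟨i | i, rfl⟩
  · exact Or.inr ⟨.inl i, rfl⟩
  refine Fin.lastCases ?_ (fun i => ?_) i
  · simp
  · simpa using Or.inr ⟨.inr i, rfl⟩

theorem PartialIso.realize_infFormula (hA : IsGood A) {Z Z' : Set Ordinal.{0}}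
    (hf : Set.range f = restr A Z) (hf' : Set.range f' = restr A Z')
    (hZ : Ranked ⊤ Z) (hZ' : Ranked ⊤ Z') (hR : Rich A Z) (hR' : Rich A Z') {n : ℕ}
    (φ : Infinitary.InfFormula.{0, 0, w} tau n) {x : Fin n → M} {y : Fin n → M'}
    (h : PartialIso ⊤ (tupleGraph f f' x y)) : φ.Realize x ↔ φ.Realize y := by
  induction φ with
  | equal s t => exact h.realize_equal s t
  | rel R ts => exact h.realize_rel R le_top ts
  | neg φ ih => exact not_congr (ih h)
  | conj φ ih => exact forall_congr' fun i => ih i h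
  | all φ ih =>
    constructor
    · intro hx b
      obtain ⟨a, ha⟩ := h.back_tuple hA hf hf' hZ hZ' hR b
      exact (ih (ha.mono (tupleGraph_snoc_subset x y a b))).1 (hx a)
    · intro hy a
      obtain ⟨b, hb⟩ := h.forth_tuple hA hf hf' hZ hZ' hR' a
      exact (ih (hb.mono (tupleGraph_snoc_subset x y a b))).2 (hy b)

/-- The level `K` only has to bound the indices of the relation symbols in `φ`; quantifiers do not
lower it. Claiming the equivalence for every `K ≥ K₀` lets the two sides of an implication share a
level. No rank hypothesis is needed, as every `Z` is ranked at a finite level. -/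
theorem exists_level_realize_boundedFormula (hA : IsGood A) {Z Z' : Set Ordinal.{0}}
    (hf : Set.range f = restr A Z) (hf' : Set.range f' = restr A Z')
    (hR : Rich A Z) (hR' : Rich A Z') {γ : Type*} [Finite γ] {n : ℕ}
    (φ : tau.BoundedFormula γ n) : ∃ K₀ : ℕ, ∀ K : ℕ, K₀ ≤ K → ∀ (v : γ → M) (v' : γ → M')
      (x : Fin n → M) (y : Fin n → M'),
      PartialIso K (tupleGraph f f' (Sum.elim v x) (Sum.elim v' y)) →
        (φ.Realize v x ↔ φ.Realize v' y) := by
  induction φ with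
  | falsum => exact ⟨0, fun _ _ _ _ _ _ _ => Iff.rfl⟩
  | equal s t => exact ⟨0, fun _ _ _ _ _ _ h => h.realize_equal s t⟩
  | rel R ts =>
    exact ⟨TauRel.level R, fun K hK _ _ _ _ h => h.realize_rel R (Nat.cast_le.2 hK) ts⟩
  | imp φ ψ ih₁ ih₂ =>
    obtain ⟨K₁, h₁⟩ := ih₁
    obtain ⟨K₂, h₂⟩ := ih₂
    refine ⟨max K₁ K₂, fun K hK v v' x y h => ?_⟩
    rw [FirstOrder.Language.BoundedFormula.realize_imp,
      FirstOrder.Language.BoundedFormula.realize_imp, h₁ K (le_of_max_le_left hK) v v' x y h,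
      h₂ K (le_of_max_le_right hK) v v' x y h]
  | all φ ih =>
    obtain ⟨K₀, h₀⟩ := ih
    refine ⟨K₀, fun K hK v v' x y h => ?_⟩
    have hZ := ranked_natCast K Z
    have hZ' := ranked_natCast K Z'
    rw [FirstOrder.Language.BoundedFormula.realize_all,
      FirstOrder.Language.BoundedFormula.realize_all]
    constructor
    · intro hx b
      obtain ⟨a, ha⟩ := h.back_tuple hA hf hf' hZ hZ' hR b
      exact (h₀ K hK _ _ _ _ (ha.mono (tupleGraph_elim_snoc_subset v v' x y a b))).1 (hx a)
    · intro hy a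
      obtain ⟨b, hb⟩ := h.forth_tuple hA hf hf' hZ hZ' hR' a
      exact (h₀ K hK _ _ _ _ (hb.mono (tupleGraph_elim_snoc_subset v v' x y a b))).2 (hy b)

theorem realize_formula_of_agree (hA : IsGood A) {Z Z' : Set Ordinal.{0}}
    (hf : Set.range f = restr A Z) (hf' : Set.range f' = restr A Z')
    (hR : Rich A Z) (hR' : Rich A Z') {γ : Type*} [Finite γ] (φ : tau.Formula γ)
    {v : γ → M} {v' : γ → M'} (hv : ∀ i, f (v i) = f' (v' i)) : φ.Realize v ↔ φ.Realize v' := by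
  obtain ⟨K, hK⟩ := exists_level_realize_boundedFormula hA hf hf' hR hR' φ
  refine hK K le_rfl v v' _ _ (PartialIso.of_diagonal _ ?_)
  rintro _ ⟨i | i, rfl⟩
  exacts [hv i, i.elim0]

end

end LarsonShelah

/-! ### Closure properties of definable sets; elementary substructures -/

section Definability

variable {L : FirstOrder.Language.{u, v}} {M : Type w} [L.Structure M] {B : Set M} {γ : Type*}

theorem Set.Definable.setOf_and {p q : (γ → M) → Prop} (hp : B.Definable L {v | p v})
    (hq : B.Definable L {v | q v}) : B.Definable L {v | p v ∧ q v} :=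
  hp.inter hq

theorem Set.Definable.setOf_or {p q : (γ → M) → Prop} (hp : B.Definable L {v | p v})
    (hq : B.Definable L {v | q v}) : B.Definable L {v | p v ∨ q v} :=
  hp.union hq

theorem Set.Definable.setOf_not {p : (γ → M) → Prop} (hp : B.Definable L {v | p v}) :
    B.Definable L {v | ¬ p v} :=
  hp.compl

theorem Set.Definable.setOf_imp {p q : (γ → M) → Prop} (hp : B.Definable L {v | p v})
    (hq : B.Definable L {v | q v}) : B.Definable L {v | p v → q v} := by
  simpa only [imp_iff_not_or] using hp.setOf_not.setOf_or hq

theorem Set.Definable.setOf_iff {p q : (γ → M) → Prop} (hp : B.Definable L {v | p v})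
    (hq : B.Definable L {v | q v}) : B.Definable L {v | p v ↔ q v} := by
  simpa only [iff_iff_implies_and_implies] using (hp.setOf_imp hq).setOf_and (hq.setOf_imp hp)

theorem Set.Definable.setOf_const (p : Prop) : B.Definable L {_v : γ → M | p} := by
  by_cases hp : p
  · simp [hp]
  · simp [hp]

theorem Set.Definable.setOf_forall_finite {ι : Type*} [Finite ι] {p : ι → (γ → M) → Prop}
    (hp : ∀ i, B.Definable L {v | p i v}) : B.Definable L {v | ∀ i, p i v} := by
  simpa only [Set.ofPred_forall] using Set.definable_iInter_of_finite hp

/-- The bound variable is the coordinate `none`; projecting it away is existential quantification.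
-/
theorem Set.Definable.setOf_exists [Finite γ] {p : (γ → M) → M → Prop}
    (hp : B.Definable L {v : Option γ → M | p (fun i => v (some i)) (v none)}) :
    B.Definable L {v | ∃ a, p v a} := by
  convert hp.image_comp some using 1
  ext v
  constructor
  · rintro ⟨a, ha⟩
    exact ⟨fun o => o.elim a v, ha, rfl⟩
  · rintro ⟨v, hv, rfl⟩
    exact ⟨_, hv⟩

theorem Set.Definable.setOf_forall [Finite γ] {p : (γ → M) → M → Prop}
    (hp : B.Definable L {v : Option γ → M | p (fun i => v (some i)) (v none)}) :
    B.Definable L {v | ∀ a, p v a} := by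
  simpa only [not_exists, not_not] using (hp.setOf_not.setOf_exists (p := fun v a => ¬ p v a)).setOf_not

theorem Set.Definable.setOf_param [Finite γ] {p : (γ → M) → M → Prop} {a : M} (ha : a ∈ B)
    (hp : B.Definable L {v : Option γ → M | p (fun i => v (some i)) (v none)}) :
    B.Definable L {v | p v a} := by
  refine hp.preimage_map (F := fun v o => o.elim a v) ?_
  rintro (_ | i)
  · exact L.definableFun_const γ ha
  · exact (L.definableFun_var i).of_empty

theorem Set.Definable.setOf_eq (i j : γ) : B.Definable L {v : γ → M | v i = v j} :=
  Set.Definable.mono (Set.empty_definable_iff.2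
    ⟨FirstOrder.Language.Term.equal (.var i) (.var j), by ext; simp⟩) (Set.empty_subset _)

/-- This is the Tarski–Vaught property, with parameters from `S`. -/
theorem FirstOrder.Language.ElementarySubstructure.exists_mem_of_definable
    (S : L.ElementarySubstructure M) {p : M → Prop}
    (hp : (S : Set M).Definable L {v : Unit → M | p (v ())}) (h : ∃ x, p x) : ∃ x ∈ S, p x := by
  obtain ⟨x, hx, hxS⟩ := S.meetsDefinable {x | p x} h (hp.preimage_comp fun _ => (0 : Fin 1))
  exact ⟨x, hxS, hx⟩

end Definability

/-! ### Definability of basic set-theoretic notions in `H(κ)` -/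

namespace LarsonShelah

namespace H

variable {κ : Cardinal.{0}}

theorem exists_of_mem (x : H κ) {y : ZFSet.{0}} (hy : y ∈ x.val) : ∃ y' : H κ, y'.val = y := by
  obtain ⟨t, ht, hxt, hc⟩ := x.2
  exact ⟨⟨y, t, ht, ht.subset_of_mem (hxt hy), hc⟩, rfl⟩

theorem eq_iff {x y : H κ} : x = y ↔ x.val = y.val :=
  Subtype.ext_iff

/-- Because `H κ` is transitive, extensionality may be tested with quantifiers over `H κ` alone.
This makes the set operations below first-order definable. -/
theorem val_eq_iff {x : H κ} {y : ZFSet.{0}} (hy : ∀ z ∈ y, ∃ z' : H κ, z'.val = z) :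
    x.val = y ↔ ∀ z : H κ, z.val ∈ x.val ↔ z.val ∈ y := by
  refine ⟨fun h z => by rw [h], fun h => ?_⟩
  ext z
  constructor
  · intro hz
    obtain ⟨z, rfl⟩ := x.exists_of_mem hz
    exact (h z).1 hz
  · intro hz
    obtain ⟨z, rfl⟩ := hy z hz
    exact (h z).2 hz

variable {B : Set (H κ)} {γ : Type*}

theorem definable_mem (i j : γ) : B.Definable setLang {v : γ → H κ | (v i).val ∈ (v j).val} := by
  refine Set.Definable.mono (Set.empty_definable_iff.2
    ⟨FirstOrder.Language.Relations.formula₂ (L := setLang) SetRel.mem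
      (FirstOrder.Language.Term.var i) (FirstOrder.Language.Term.var j), ?_⟩) (Set.empty_subset _)
  ext v
  rw [Set.mem_ofPred_eq, Set.mem_ofPred_eq]
  exact (FirstOrder.Language.Formula.realize_rel₂ (L := setLang) (M := H κ) (R := SetRel.mem)
    (t₁ := FirstOrder.Language.Term.var i) (t₂ := FirstOrder.Language.Term.var j)).symm

theorem definable_eq_insert [Finite γ] (i j : γ) :
    B.Definable setLang {v : γ → H κ | (v i).val = insert (v j).val (v j).val} := by
  have : {v : γ → H κ | (v i).val = insert (v j).val (v j).val} =
      {v : γ → H κ | ∀ z : H κ, z.val ∈ (v i).val ↔ z = v j ∨ z.val ∈ (v j).val} := by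
    ext v
    refine (val_eq_iff ?_).trans (by simp only [ZFSet.mem_insert_iff, eq_iff, Set.mem_ofPred_eq])
    intro z hz
    rcases ZFSet.mem_insert_iff.1 hz with rfl | hz
    exacts [⟨_, rfl⟩, (v j).exists_of_mem hz]
  rw [this]
  exact .setOf_forall <| (definable_mem none (some i)).setOf_iff <|
    .setOf_or (.setOf_eq none (some j)) (definable_mem none (some j))

theorem definable_eq_upair [Finite γ] (i j k : γ) :
    B.Definable setLang {v : γ → H κ | (v i).val = {(v j).val, (v k).val}} := by
  have : {v : γ → H κ | (v i).val = {(v j).val, (v k).val}} =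
      {v : γ → H κ | ∀ z : H κ, z.val ∈ (v i).val ↔ z = v j ∨ z = v k} := by
    ext v
    refine (val_eq_iff ?_).trans (by simp only [ZFSet.mem_pair, eq_iff, Set.mem_ofPred_eq])
    intro z hz
    rcases ZFSet.mem_pair.1 hz with rfl | rfl <;> exact ⟨_, rfl⟩
  rw [this]
  exact .setOf_forall <| (definable_mem none (some i)).setOf_iff <|
    .setOf_or (.setOf_eq none (some j)) (.setOf_eq none (some k))

theorem definable_eq_pair [Finite γ] (i j k : γ) :
    B.Definable setLang {v : γ → H κ | (v i).val = ZFSet.pair (v j).val (v k).val} := by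
  have : {v : γ → H κ | (v i).val = ZFSet.pair (v j).val (v k).val} =
      {v : γ → H κ | ∃ s t : H κ, s.val = {(v j).val, (v j).val} ∧ t.val = {(v j).val, (v k).val} ∧
        (v i).val = {s.val, t.val}} := by
    ext v
    simp only [Set.mem_ofPred_eq, ZFSet.pair, ZFSet.pair_eq_singleton]
    constructor
    · intro h
      obtain ⟨s, hs⟩ := (v i).exists_of_mem (y := {(v j).val}) (by simp [h])
      obtain ⟨t, ht⟩ := (v i).exists_of_mem (y := {(v j).val, (v k).val}) (by simp [h])
      exact ⟨s, t, hs, ht, by rw [h, hs, ht]⟩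
    · rintro ⟨s, t, hs, ht, h⟩
      rw [h, hs, ht]
  rw [this]
  exact .setOf_exists <| .setOf_exists <|
    (definable_eq_upair (some none) (some (some j)) (some (some j))).setOf_and <|
    (definable_eq_upair none (some (some j)) (some (some k))).setOf_and <|
    definable_eq_upair (some (some i)) (some none) none

/-- `p` is a triple `((x, l), B)`. -/
theorem definable_eq_triple [Finite γ] (p x l C : γ) :
    B.Definable setLang
      {v : γ → H κ | (v p).val = ZFSet.pair (ZFSet.pair (v x).val (v l).val) (v C).val} := by
  have : {v : γ → H κ | (v p).val = ZFSet.pair (ZFSet.pair (v x).val (v l).val) (v C).val} =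
      {v : γ → H κ | ∃ q : H κ, q.val = ZFSet.pair (v x).val (v l).val ∧
        (v p).val = ZFSet.pair q.val (v C).val} := by
    ext v
    simp only [Set.mem_ofPred_eq]
    constructor
    · intro h
      obtain ⟨s, hs⟩ := (v p).exists_of_mem
        (y := {ZFSet.pair (v x).val (v l).val}) (by simp [h, ZFSet.pair])
      obtain ⟨q, hq⟩ := s.exists_of_mem (y := ZFSet.pair (v x).val (v l).val) (by simp [hs])
      exact ⟨q, hq, by rw [h, hq]⟩
    · rintro ⟨q, hq, h⟩
      rw [h, hq]
  rw [this]
  exact .setOf_exists <| (definable_eq_pair none (some x) (some l)).setOf_and <|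
    definable_eq_pair (some p) none (some C)

/-- `x` is the `k`-th successor of a set that is not a successor. -/
def ModEq : ℕ → H κ → Prop
  | 0, x => ¬ ∃ y : H κ, x.val = insert y.val y.val
  | k + 1, x => ∃ y : H κ, x.val = insert y.val y.val ∧ ModEq k y

theorem definable_modEq [Finite γ] (k : ℕ) (i : γ) :
    B.Definable setLang {v : γ → H κ | ModEq k (v i)} := by
  induction k generalizing γ with
  | zero => exact (Set.Definable.setOf_exists (definable_eq_insert (some i) none)).setOf_not
  | succ k ih =>
    exact .setOf_exists <| (definable_eq_insert (some i) none).setOf_and (ih none)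

theorem eq_insert_iff {o : Ordinal.{0}} {y : ZFSet.{0}} :
    o.toZFSet = insert y y ↔ ∃ a : Ordinal.{0}, y = a.toZFSet ∧ o = a + 1 := by
  constructor
  · intro h
    obtain ⟨a, -, rfl⟩ := Ordinal.mem_toZFSet_iff.1 (show y ∈ o.toZFSet by simp [h])
    exact ⟨a, rfl, Ordinal.toZFSet_injective (by rw [h, Ordinal.toZFSet_add_one])⟩
  · rintro ⟨a, rfl, rfl⟩
    exact Ordinal.toZFSet_add_one a

theorem add_one_mod_omega0 (a : Ordinal.{0}) :
    (a + 1) % Ordinal.omega0 = a % Ordinal.omega0 + 1 := by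
  obtain ⟨k, hk⟩ := exists_mod_omega0_eq a
  have h := Ordinal.div_add_mod a Ordinal.omega0
  conv_lhs => rw [← h, add_assoc, Ordinal.mul_add_mod_self, hk]
  rw [hk]
  exact Ordinal.mod_eq_of_lt (by exact_mod_cast Ordinal.natCast_lt_omega0 (k + 1))

theorem exists_pred {k : ℕ} {x : H κ} {o : Ordinal.{0}} (hx : x.val = o.toZFSet)
    (hk : o % Ordinal.omega0 = (k + 1 : ℕ)) :
    ∃ (y : H κ) (a : Ordinal.{0}), y.val = a.toZFSet ∧ o = a + 1 ∧ a % Ordinal.omega0 = k := by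
  obtain ⟨a, ha, hak⟩ : ∃ a : Ordinal.{0}, o = a + 1 ∧ a % Ordinal.omega0 = k := by
    refine ⟨Ordinal.omega0 * (o / Ordinal.omega0) + k, ?_, ?_⟩
    · rw [add_assoc, ← Nat.cast_succ, ← hk, Ordinal.div_add_mod]
    · rw [Ordinal.mul_add_mod_self]
      exact Ordinal.mod_eq_of_lt (Ordinal.natCast_lt_omega0 k)
  obtain ⟨y, hy⟩ := x.exists_of_mem (y := a.toZFSet) (by
    rw [hx, ha, Ordinal.toZFSet_mem_toZFSet_iff]; exact Order.lt_add_one_iff.2 le_rfl)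
  exact ⟨y, a, hy, ha, hak⟩

/-- An ordinal has residue `0` exactly when it is not a successor, and taking successors raises the
residue by one; so residues are definable without ordinal arithmetic. -/
theorem modEq_iff {k : ℕ} {x : H κ} {o : Ordinal.{0}} (hx : x.val = o.toZFSet) :
    ModEq k x ↔ o % Ordinal.omega0 = k := by
  induction k generalizing x o with
  | zero =>
    simp only [ModEq, hx, eq_insert_iff, Nat.cast_zero]
    constructor
    · intro h
      obtain ⟨k, hk⟩ := exists_mod_omega0_eq o
      rcases k with _ | k
      · simpa using hk
      · obtain ⟨y, a, hy, ha, -⟩ := exists_pred hx hk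
        exact absurd ⟨y, a, hy, ha⟩ h
    · rintro h ⟨y, a, -, rfl⟩
      rw [add_one_mod_omega0] at h
      simp at h
  | succ k ih =>
    simp only [ModEq, hx, eq_insert_iff]
    constructor
    · rintro ⟨y, ⟨a, hy, rfl⟩, hk⟩
      rw [add_one_mod_omega0, (ih hy).1 hk, Nat.cast_succ]
    · intro hk
      obtain ⟨y, a, hy, ha, hak⟩ := exists_pred hx hk
      exact ⟨y, ⟨a, hy, ha⟩, (ih hy).2 hak⟩

end H

/-! ### Elementary submodels of `H((2^ℵ₀)⁺)` -/

theorem exists_H_toZFSet {o : Ordinal.{0}} (ho : o ≤ cont) :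
    ∃ x : H (Order.succ continuum), x.val = o.toZFSet := by
  refine ⟨⟨o.toZFSet, o.toZFSet, (ZFSet.isOrdinal_toZFSet o).isTransitive, fun _ h => h, ?_⟩, rfl⟩
  rw [Ordinal.card_toZFSet, Order.lt_succ_iff]
  simpa [cont] using Ordinal.card_le_card ho

theorem natCast_le_cont (n : ℕ) : (n : Ordinal.{0}) ≤ cont :=
  (Ordinal.natCast_lt_omega0 n).le.trans (by
    rw [cont, ← Cardinal.ord_aleph0]
    exact Cardinal.ord_le_ord.2 aleph0_le_continuum)

namespace Submodel

variable (X : Submodel)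

/-- The empty set is definable, and each successor is definable from its predecessor. -/
theorem has_natCast (n : ℕ) : X.Has (n : Ordinal.{0}).toZFSet := by
  induction n with
  | zero =>
    obtain ⟨x, hxX, hx⟩ := X.exists_mem_of_definable
      (p := fun x => ∀ z : H (Order.succ continuum), ¬ z.val ∈ x.val)
      (.setOf_forall (H.definable_mem none (some ())).setOf_not) (by
        obtain ⟨x, hx⟩ := exists_H_toZFSet (natCast_le_cont 0)
        exact ⟨x, by simp [hx]⟩)
    refine ⟨x, hxX, (H.val_eq_iff (by simp)).2 (by simpa using hx)⟩
  | succ n ih =>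
    obtain ⟨y, hyX, hy⟩ := ih
    obtain ⟨x, hxX, hx⟩ := X.exists_mem_of_definable
      (p := fun x => x.val = insert y.val y.val)
      (.setOf_param (p := fun v y => (v ()).val = insert y.val y.val) hyX
        (H.definable_eq_insert (some ()) none)) (by
        obtain ⟨x, hx⟩ := exists_H_toZFSet (natCast_le_cont (n + 1))
        exact ⟨x, by rw [hx, hy, Nat.cast_succ, Ordinal.toZFSet_add_one]⟩)
    exact ⟨x, hxX, by rw [hx, hy, Nat.cast_succ, Ordinal.toZFSet_add_one]⟩

end Submodel

/-! ### The coded sequence inside `H(κ)` and richness of `𝒳` -/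

theorem mem_codeSeq {A : SetSeq} {p : ZFSet.{0}} : p ∈ codeSeq A ↔ ∃ (α : Idx) (n : ℕ),
    p = ZFSet.pair (ZFSet.pair (α : Ordinal.{0}).toZFSet (n : Ordinal.{0}).toZFSet)
      (codeSet (A α n)) := by
  simp [codeSeq, Prod.exists, eq_comm]

theorem natCast_mem_codeSet {B : Set ℕ} {i : ℕ} : (i : Ordinal.{0}).toZFSet ∈ codeSet B ↔ i ∈ B := by
  simp [codeSet, Ordinal.toZFSet_injective.eq_iff]

variable {A : SetSeq} {κ : Cardinal.{0}}

/-- `((x, l), C)` is an element of `S` for some `C` that contains `i`. -/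
def AppMem (S l i x : H κ) : Prop :=
  ∃ C p : H κ, i.val ∈ C.val ∧ p.val ∈ S.val ∧
    p.val = ZFSet.pair (ZFSet.pair x.val l.val) C.val

/-- `((x, l), C)` is an element of `S` for some `C`. -/
def AppDom (S l x : H κ) : Prop :=
  ∃ C p : H κ, p.val ∈ S.val ∧ p.val = ZFSet.pair (ZFSet.pair x.val l.val) C.val

theorem definable_appMem {B : Set (H κ)} {γ : Type*} [Finite γ] {S l i : H κ} (hS : S ∈ B)
    (hl : l ∈ B) (hi : i ∈ B) (x : γ) : B.Definable setLang {v : γ → H κ | AppMem S l i (v x)} :=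
  .setOf_param (p := fun v S => AppMem S l i (v x)) hS <|
  .setOf_param (p := fun v l => AppMem (v none) l i (v (some x))) hl <|
  .setOf_param (p := fun v i => AppMem (v (some none)) (v none) i (v (some (some x)))) hi <|
  .setOf_exists <| .setOf_exists <|
    (H.definable_mem (some (some none)) (some none)).setOf_and <|
    (H.definable_mem none (some (some (some (some none))))).setOf_and <|
    H.definable_eq_triple none (some (some (some (some (some x))))) (some (some (some none)))
      (some none)

theorem definable_appDom {B : Set (H κ)} {γ : Type*} [Finite γ] {S l : H κ} (hS : S ∈ B)
    (hl : l ∈ B) (x : γ) : B.Definable setLang {v : γ → H κ | AppDom S l (v x)} :=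
  .setOf_param (p := fun v S => AppDom S l (v x)) hS <|
  .setOf_param (p := fun v l => AppDom (v none) l (v (some x))) hl <|
  .setOf_exists <| .setOf_exists <|
    (H.definable_mem none (some (some (some none)))).setOf_and <|
    H.definable_eq_triple none (some (some (some (some x)))) (some (some none)) (some none)

/-- Transitivity of `H κ` puts the components of the triple into `H κ`, so the existential
quantifiers in `AppMem` and `AppDom` find their witnesses. -/
theorem exists_triple_codeSeq {S : H κ} (hS : S.val = codeSeq A) (α : Idx) (n : ℕ) :
    ∃ C p : H κ, C.val = codeSet (A α n) ∧ p.val ∈ S.val ∧ p.val =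
      ZFSet.pair (ZFSet.pair (α : Ordinal.{0}).toZFSet (n : Ordinal.{0}).toZFSet) C.val := by
  have hp := mem_codeSeq.2 ⟨α, n, (rfl : _ = ZFSet.pair _ (codeSet (A α n)))⟩
  rw [← hS] at hp
  obtain ⟨p, hp'⟩ := S.exists_of_mem hp
  obtain ⟨q, hq⟩ := p.exists_of_mem (y := {ZFSet.pair (α : Ordinal.{0}).toZFSet
    (n : Ordinal.{0}).toZFSet, codeSet (A α n)}) (by rw [hp']; simp [ZFSet.pair])
  obtain ⟨C, hC⟩ := q.exists_of_mem (y := codeSet (A α n)) (by rw [hq]; simp)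
  exact ⟨C, p, hC, hp' ▸ hp, by rw [hp', hC]⟩

theorem appMem_iff {S l i x : H κ} (hS : S.val = codeSeq A) {n j : ℕ} {α : Idx}
    (hl : l.val = (n : Ordinal.{0}).toZFSet) (hi : i.val = (j : Ordinal.{0}).toZFSet)
    (hx : x.val = (α : Ordinal.{0}).toZFSet) : AppMem S l i x ↔ j ∈ A α n := by
  constructor
  · rintro ⟨C, p, hiC, hp, hpe⟩
    rw [hS, mem_codeSeq] at hp
    obtain ⟨β, m, h⟩ := hp
    rw [hpe, hl, hx] at h
    simp only [ZFSet.pair_inj, Ordinal.toZFSet_injective.eq_iff, Nat.cast_inj] at h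
    obtain ⟨⟨h₁, rfl⟩, hC⟩ := h
    obtain rfl := Subtype.ext h₁
    rwa [hC, hi, natCast_mem_codeSet] at hiC
  · intro h
    obtain ⟨C, p, hC, hp, hpe⟩ := exists_triple_codeSeq hS α n
    exact ⟨C, p, by rwa [hi, hC, natCast_mem_codeSet], hp, by rw [hpe, hx, hl]⟩

theorem AppDom.exists_idx {S l x : H κ} (hS : S.val = codeSeq A) (h : AppDom S l x) :
    ∃ α : Idx, x.val = (α : Ordinal.{0}).toZFSet := by
  obtain ⟨C, p, hp, hpe⟩ := h
  rw [hS, mem_codeSeq] at hp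
  obtain ⟨β, m, h⟩ := hp
  rw [hpe] at h
  simp only [ZFSet.pair_inj] at h
  exact ⟨β, h.1.1⟩

theorem appDom_of_idx {S l x : H κ} (hS : S.val = codeSeq A) {n : ℕ} {α : Idx}
    (hl : l.val = (n : Ordinal.{0}).toZFSet) (hx : x.val = (α : Ordinal.{0}).toZFSet) :
    AppDom S l x := by
  obtain ⟨C, p, -, hp, hpe⟩ := exists_triple_codeSeq hS α n
  exact ⟨C, p, hp, by rw [hpe, hx, hl]⟩

theorem rich_ordinals (hA : IsGood A) (X : Submodel) (hX : X.Has (codeSeq A)) :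
    Rich A (Set.Iio cont ∩ X.ordinals) := by
  intro k n m s F hF
  obtain ⟨S, hSX, hS⟩ := hX
  choose N hNX hN using X.has_natCast
  -- Only excluded indices lying in `X` may serve as parameters; the others cannot be hit by an
  -- element of `X`. Excluding the top index as well requires no decision whether it belongs to `X`.
  let G : Set (H (Order.succ continuum)) :=
    {x | x ∈ X ∧ ∃ α ∈ Insert.insert topIdx F, x.val = (α : Ordinal.{0}).toZFSet}
  have hG : G.Finite := by
    refine ((hF.insert topIdx).image fun α : Idx => (α : Ordinal.{0}).toZFSet).preimage
      (f := fun x : H (Order.succ continuum) => x.val)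
      (fun _ _ _ _ h => Subtype.ext h) |>.subset ?_
    rintro x ⟨-, α, hα, h⟩
    exact ⟨α, hα, h.symm⟩
  have := hG.to_subtype
  -- The conjunct `AppDom` forces `x` to be an ordinal `≤ 2^ℵ₀`, since it lies in the domain of the
  -- coded sequence.
  obtain ⟨x, hxX, hd, hk, hs, hxG⟩ := X.exists_mem_of_definable
    (p := fun x => AppDom S (N 0) x ∧ H.ModEq k x ∧
      (∀ (l : Fin n) (i : Fin m), AppMem S (N l) (N i) x ↔ (i : ℕ) ∈ s l) ∧ ∀ g : G, x ≠ g)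
    (.setOf_and (definable_appDom hSX (hNX 0) ()) <|
      .setOf_and (H.definable_modEq k ()) <|
      .setOf_and (.setOf_forall_finite fun l => .setOf_forall_finite fun i =>
        (definable_appMem hSX (hNX l) (hNX i) ()).setOf_iff (.setOf_const _)) <|
      .setOf_forall_finite fun g => .setOf_not <|
        .setOf_param (p := fun v a => v () = a) g.2.1 (.setOf_eq (some ()) none)) (by
    obtain ⟨α, hα, -, hαF, hαk, hαs⟩ := hA.rich k n m s (Insert.insert topIdx F) (hF.insert _)
    obtain ⟨x, hx⟩ := exists_H_toZFSet α.2
    refine ⟨x, appDom_of_idx hS (hN 0) hx, (H.modEq_iff hx).2 hαk, fun l i => ?_, ?_⟩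
    · rw [appMem_iff hS (hN l) (hN i) hx, hαs l l.2 i i.2]
    · rintro ⟨g, hg, β, hβ, hgβ⟩ rfl
      rw [hx, Ordinal.toZFSet_injective.eq_iff] at hgβ
      exact hαF (Subtype.ext hgβ ▸ hβ))
  obtain ⟨α, hα⟩ := hd.exists_idx hS
  have hαF : α ∉ Insert.insert topIdx F := fun h => hxG ⟨x, hxX, α, h, hα⟩ rfl
  rw [Set.mem_insert_iff, not_or] at hαF
  have hlt := lt_cont_of_ne_topIdx hαF.1
  refine ⟨α, ⟨hlt, x, hxX, hα⟩, hlt, hαF.2, (H.modEq_iff hα).1 hk, fun l hl i hi => ?_⟩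
  rw [← appMem_iff hS (hN l) (hN i) hα]
  exact hs ⟨l, hl⟩ ⟨i, hi⟩

end LarsonShelah

/-! ### Cardinalities and the elementary inclusions -/

namespace LarsonShelah

variable {A : SetSeq}

theorem uncountable_N₁ (A : SetSeq) : Uncountable (N₁ A) := by
  let g : Set.Iio cont → N₁ A := fun α =>
    ⟨.c ⟨α, Set.mem_Iic.2 α.2.le⟩, c_mem_restr.2 α.2⟩
  have hg : Function.Injective g := fun α β h => by
    simpa [g, Subtype.ext_iff] using h
  have : Uncountable (Set.Iio cont) := by
    rw [← Cardinal.aleph0_lt_mk_iff, Cardinal.mk_Iio_ordinal]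
    simpa [cont] using Cardinal.aleph0_lt_continuum
  exact hg.uncountable

theorem countable_M₁ (A : SetSeq) {X : Submodel}
    (hX : (X : Set (H (Order.succ Cardinal.continuum))).Countable) : Countable (M₁ A X) := by
  have hord : X.ordinals.Countable := by
    refine (hX.image fun x => x.val).preimage_of_injOn
      (f := Ordinal.toZFSet) (Ordinal.toZFSet_injective.injOn) |>.mono ?_
    rintro o ⟨x, hx, h⟩
    exact ⟨x, hx, h⟩
  have hidx : {α : Idx | (α : Ordinal) ∈ X.ordinals}.Countable :=
    hord.preimage Subtype.val_injective
  refine Set.Countable.to_subtype (s := (M₁ A X : Set (N₂ A))) <|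
    ((Set.countable_range (N₂.b : ℕ → N₂ A)).union (hidx.image N₂.c)).mono ?_
  rintro _ (⟨i, rfl⟩ | ⟨α, hα, rfl⟩)
  exacts [Or.inl ⟨i, rfl⟩, Or.inr ⟨α, hα.2, rfl⟩]

theorem restr_mono (A : SetSeq) {Z Z' : Set Ordinal.{0}} (h : Z ⊆ Z') : restr A Z ≤ restr A Z' := by
  rintro _ (⟨i, rfl⟩ | ⟨α, hα, rfl⟩)
  exacts [b_mem_restr, c_mem_restr.2 (h hα)]

theorem range_subtype (Z : Set Ordinal.{0}) :
    Set.range (restr A Z).subtype = restr A Z := by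
  simp

theorem IsGood.isElementary_restr (hA : IsGood A) {Z : Set Ordinal.{0}} (hZ : Rich A Z) :
    (restr A Z).IsElementary := by
  intro n φ x
  refine realize_formula_of_agree (f := FirstOrder.Language.Embedding.refl tau (N₂ A))
    (f' := (restr A Z).subtype) (Z := Set.univ) hA ?_ (range_subtype Z)
    (hZ.mono (Set.subset_univ _)) hZ φ fun _ => rfl
  ext x
  rcases x with i | α
  · exact iff_of_true ⟨.b i, rfl⟩ b_mem_restr
  · exact iff_of_true ⟨.c α, rfl⟩ (c_mem_restr.2 trivial)

theorem IsGood.elemSub_restr (hA : IsGood A) {Z Z' : Set Ordinal.{0}} (hZ : Rich A Z)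
    (h : Z ⊆ Z') : Infinitary.ElemSub (restr A Z) (restr A Z') :=
  ⟨restr_mono A h, fun _ φ _ => realize_formula_of_agree (f := (restr A Z').subtype)
    (f' := (restr A Z).subtype) hA (range_subtype Z') (range_subtype Z) (hZ.mono h) hZ φ
    fun _ => rfl⟩

/-- Keeping `Z'` below `2^ℵ₀` makes both sets ranked at level `⊤`, as the infinitary game requires;
the initial position is the identity on the given tuple. -/
theorem IsGood.infElemSub_restr (hA : IsGood A) {Z Z' : Set Ordinal.{0}} (hZ : Rich A Z)
    (h : Z ⊆ Z') (hZ' : Z' ⊆ Set.Iio cont) :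
    Infinitary.InfElemSub.{0, 0, w} (restr A Z) (restr A Z') := by
  refine ⟨restr_mono A h, fun _ φ _ => PartialIso.realize_infFormula (f := (restr A Z').subtype)
    (f' := (restr A Z).subtype) hA (range_subtype Z') (range_subtype Z)
    (ranked_of_subset_Iio _ hZ') (ranked_of_subset_Iio _ (h.trans hZ')) (hZ.mono h) hZ φ
    (PartialIso.of_diagonal _ ?_)⟩
  rintro _ ⟨i, rfl⟩
  rfl

end LarsonShelah

theorem Infinitary.InfElemSub.infEquiv {L : FirstOrder.Language.{u, v}} {M : Type u'}
    [L.Structure M] {S T : L.Substructure M} (h : InfElemSub.{u, v, w} S T) :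
    InfEquiv.{u, v, w} L S T := by
  obtain ⟨hle, h⟩ := h
  intro φ
  rw [← h 0 φ Fin.elim0]
  exact iff_of_eq (congrArg _ (Subsingleton.elim _ _))

theorem proposition1 (A : LarsonShelah.SetSeq) (hA : LarsonShelah.IsGood A)
    (X : LarsonShelah.Submodel)
    (hXcountable : (X : Set (LarsonShelah.H (Order.succ Cardinal.continuum))).Countable)
    (hAX : LarsonShelah.Submodel.Has X (LarsonShelah.codeSeq A)) :
    (LarsonShelah.N₁ A).IsElementary ∧
    Infinitary.ElemSub (LarsonShelah.M₁ A X) (LarsonShelah.M₂ A X) ∧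
    Infinitary.InfElemSub.{0, 0, w} (LarsonShelah.M₁ A X) (LarsonShelah.N₁ A) ∧
    Infinitary.Extendible.{0, 0, w} LarsonShelah.tau (LarsonShelah.M₁ A X) := by
  have hM := LarsonShelah.rich_ordinals hA X hAX
  have hinf : Infinitary.InfElemSub.{0, 0, w} (LarsonShelah.M₁ A X) (LarsonShelah.N₁ A) :=
    hA.infElemSub_restr hM Set.inter_subset_left Set.Subset.rfl
  exact ⟨hA.isElementary_restr hA.rich,
    hA.elemSub_restr hM (Set.inter_subset_inter_left _ (Set.Iio_subset_Iio le_self_add)), hinf,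
    LarsonShelah.countable_M₁ A hXcountable, LarsonShelah.N₁ A, inferInstance,
    LarsonShelah.uncountable_N₁ A, hinf.infEquiv⟩
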